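/- Let $n\ge 1$, $m\ge 1$, and write $x=(x',x_n)\in\mathbb R^{n-1}\times\mathbb R$. Define $P_1(y_1,t)=t-y_1$ and, for $k\ge 1$, $$P_{k+1}(y_1,\dots,y_{k+1},t)=P_k\big(a_1,\dots,a_k,(t-(y_1+\cdots+y_{k+1}))^2\big),\qquad a_j=y_{j+1}(y_1+\cdots+y_j).$$ For $k\ge 2$ put $C_k=1-\sqrt{\tfrac{k-1}{k}}$, $\ell(k)=(k+1)2^{k-1}-k^2+k$ and $$Q_k(y_1,\dots,y_k,t)=\Big(\frac t{C_k}+y_k\Big)^{\ell(k)}(y_1\cdots y_k)^{2^{k-1}}P_k\Big(y_1,\dots,y_{k-1},\frac1{y_1\cdots y_k},t\Big),$$ which is a polynomial because $P_k$ is homogeneous of degree $2^{k-1}$. Let $g=(g_1,\dots,g_{m+1})$ be a tuple of polynomials in $\mathbb R[x_1,\dots,x_{n-1}]$ with $g_{m+1}>1$ on $\mathbb R^{n-1}$. Consider the polynomial $$Q_g(x',x_n)=g_{m+1}(x')^{2\ell(m+1)+2^{m+1}}\,Q_{m+1}\Big(g_1(x'),\dots,g_m(x'),1,\frac{C_{m+1}x_n^2}{g_{m+1}(x')^2}\Big)\in\mathbb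 R[x_1,\dots,x_n]$$ and the sets $$A_g=\{x\in\mathbb R^n: g_1(x')>0,\dots,g_m(x')>0,\ x_n=0\},\qquad S_g=\{x+\lambda e_n:\ Q_g(x)\le 0,\ x_n>0,\ \lambda\ge 0\},$$ where $e_n=(0,\dots,0,1)$. Write $A_g+\mathbb Re_n$ and $A_g+\mathbb R_{\ge0}e_n$ for the vertical cylinder and the positive vertical cylinder over $A_g$. Theorem 3.5. Let $h\in\mathbb R[x_1,\dots,x_{n-1}]$ and $P\in\mathbb R[x_1,\dots,x_n]$ be such that $h(x')\ge0$ and $g_{m+1}(x')>h(x')$ for every $(x',0)\in A_g$, and $P>1$ on $S_g$. Define $f=(f_1,\dots,f_n):\mathbb R^n\to\mathbb R^n$ by $$f(x)=\big(x',\ x_n(1+P(x)Q_g(x))^2+h(x')(P(x)Q_g(x))^2\big).$$ Then: (i) $(A_g+\mathbb Re_n)\cap\{x_n\ge h(x')\}\subset f(S_g)\subset(A_g+\mathbb Re_n)\cap\{2x_n\ge h(x')\}$. In particular, if $h=0$, then $f(S_g)=A_g+\mathbb R_{\ge0}e_n$. (ii) If $x_n\ge0$, $P(x)Q_g(x)\ge0$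 and $h(x')\ge0$, then $f_n(x)\ge x_n$. In particular, these three hypotheses hold, and hence $f_n(x)\ge x_n$, for every $x\in\big((A_g+\mathbb R_{\ge0}e_n)\setminus S_g\big)\cap\{P\ge0\}$. (iii) If $x'\in\mathbb R^{n-1}$ is such that $h(x')\ge0$ and $P(x',x_n)\ge0$ for all large enough $x_n$, then $\lim_{x_n\to+\infty}f_n(x',x_n)=+\infty$. -/

import Mathlib

namespace Pecker

/-! ### Pecker's polynomials

Points of `ℝⁿ` with `n = d + 1` are functions `x : Fin (d + 1) → ℝ`; the first `d` coordinates
`x'` of `x` are `Fin.init x`, the last coordinate `x_n` is `x (Fin.last d)`.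
`ℝ[x']` is `MvPolynomial (Fin d) ℝ` and `ℝ[x]` is `MvPolynomial (Fin (d + 1)) ℝ`.
Tuples are indexed from `0`. The polynomials with integer or real coefficients in `y_1, …, y_{m+1}, t`
below are given through their values in an arbitrary commutative ring (or `ℝ`-algebra), so that they
can be evaluated at numbers and at polynomials alike. -/

/-- `a_k(y_1, …, y_{k+1}) = y_{k+1} (y_1 + ⋯ + y_k)` for `k = 1, …, m + 1`. -/
def auxA {R : Type*} [CommRing R] {m : ℕ} (y : Fin (m + 2) → R) (k : Fin (m + 1)) : R :=
  y k.succ * ∑ i ∈ Finset.Iic k.castSucc, y i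

/-- `peckerP m y t` is Pecker's polynomial `P_{m+1}(y_1, …, y_{m+1}, t)`, with
`P_1(y_1, t) = t - y_1` and
`P_{m+1}(y_1, …, y_{m+1}, t) = P_m(a_1, …, a_m, (t - (y_1 + ⋯ + y_{m+1}))²)`. -/
def peckerP {R : Type*} [CommRing R] : (m : ℕ) → (Fin (m + 1) → R) → R → R
  | 0, y, t => t - y 0
  | m + 1, y, t => peckerP m (auxA y) ((t - ∑ i, y i) ^ 2)

/-- `C_m = 1 - √((m - 1) / m)` (used for `m ≥ 1`). -/
noncomputable def constC (m : ℕ) : ℝ := 1 - Real.sqrt (((m : ℝ) - 1) / m)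

/-- `ℓ(m) = (m + 1) 2^{m-1} - m² + m` (used for `m ≥ 1`; see `ell_cast`). -/
def ell (m : ℕ) : ℕ := (m + 1) * 2 ^ (m - 1) - m * (m - 1)

/-- `modF m y t` is the polynomial
`F_{m+1} = (y_1 ⋯ y_{m+1})^{2^m} P_{m+1}(y_1, …, y_m, 1 / (y_1 ⋯ y_{m+1}), t)`
with denominators cleared: since `P_{m+1}` is homogeneous of degree `2^m`,
it is `P_{m+1}(π y_1, …, π y_m, 1, π t)` with `π = y_1 ⋯ y_{m+1}`; see `modF_eq`. -/
def modF {R : Type*} [CommRing R] (m : ℕ) (y : Fin (m + 1) → R) (t : R) : R :=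
  peckerP m (Fin.snoc (α := fun _ => R) (fun i : Fin m => (∏ j, y j) * y i.castSucc) 1)
    ((∏ j, y j) * t)

/-- The modified Pecker polynomial
`Q_{m+1}(y_1, …, y_{m+1}, t) = (t / C_{m+1} + y_{m+1})^{ℓ(m+1)} F_{m+1}(y_1, …, y_{m+1}, t)`. -/
noncomputable def modQ (m : ℕ) (y : Fin (m + 1) → ℝ) (t : ℝ) : ℝ :=
  (t / constC (m + 1) + y (Fin.last m)) ^ ell (m + 1) * modF m y t

/-- A tuple `(g_1, …, g_{m+1})` in `ℝ[x']` is admissible if `m ≥ 1` and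
`g_{m+1} > 1` on `ℝ^{n-1}`. -/
def IsAdmissible {d m : ℕ} (g : Fin (m + 1) → MvPolynomial (Fin d) ℝ) : Prop :=
  1 ≤ m ∧ ∀ x' : Fin d → ℝ, 1 < MvPolynomial.eval x' (g (Fin.last m))

/-- The polynomial
`Q_g(x', x_n) = g_{m+1}^{ℓ₀} Q_{m+1}(g_1, …, g_m, 1, x_n² C_{m+1} / g_{m+1}²)`, where
`ℓ₀ = 2 ℓ(m+1) + 2^{m+1}`, with denominators cleared: writing `G = g_{m+1}`, `π = g_1 ⋯ g_m`, it is
`(x_n² + G²)^{ℓ(m+1)} P_{m+1}(G² π g_1, …, G² π g_m, G², π C_{m+1} x_n²)`; see `eval_polyQ`. -/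
noncomputable def polyQ {d m : ℕ} (g : Fin (m + 1) → MvPolynomial (Fin d) ℝ) :
    MvPolynomial (Fin (d + 1)) ℝ :=
  let γ : Fin (m + 1) → MvPolynomial (Fin (d + 1)) ℝ :=
    fun i => MvPolynomial.rename Fin.castSucc (g i)
  let G := γ (Fin.last m)
  let π := ∏ i : Fin m, γ i.castSucc
  let xn : MvPolynomial (Fin (d + 1)) ℝ := MvPolynomial.X (Fin.last d)
  (xn ^ 2 + G ^ 2) ^ ell (m + 1) *
    peckerP m
      (Fin.snoc (α := fun _ => MvPolynomial (Fin (d + 1)) ℝ)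
        (fun i : Fin m => G ^ 2 * π * γ i.castSucc) (G ^ 2))
      (π * MvPolynomial.C (constC (m + 1)) * xn ^ 2)

/-! ### Cylinders, the sets `A_g` and `S_g`, and the map `f` -/

/-- The vector `e_n`. -/
def eN (d : ℕ) : Fin (d + 1) → ℝ := Pi.single (Fin.last d) 1

/-- The cylinder `{x + λ v : x ∈ X, λ ∈ ℝ}`. -/
def cyl {d : ℕ} (X : Set (Fin (d + 1) → ℝ)) (v : Fin (d + 1) → ℝ) : Set (Fin (d + 1) → ℝ) :=
  {z | ∃ x ∈ X, ∃ c : ℝ, z = x + c • v}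

/-- The positive cylinder `{x + λ v : x ∈ X, λ ≥ 0}`. -/
def posCyl {d : ℕ} (X : Set (Fin (d + 1) → ℝ)) (v : Fin (d + 1) → ℝ) : Set (Fin (d + 1) → ℝ) :=
  {z | ∃ x ∈ X, ∃ c : ℝ, 0 ≤ c ∧ z = x + c • v}

/-- `A_g = {g_1 > 0, …, g_m > 0, x_n = 0}`. -/
def setA {d m : ℕ} (g : Fin (m + 1) → MvPolynomial (Fin d) ℝ) : Set (Fin (d + 1) → ℝ) :=
  {x | (∀ i : Fin m, 0 < MvPolynomial.eval (Fin.init x) (g i.castSucc)) ∧ x (Fin.last d) = 0}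

/-- `S_g`, the positive cylinder in the direction `e_n` of `{Q_g ≤ 0, x_n > 0}`. -/
def setS {d m : ℕ} (g : Fin (m + 1) → MvPolynomial (Fin d) ℝ) : Set (Fin (d + 1) → ℝ) :=
  posCyl {x | MvPolynomial.eval x (polyQ g) ≤ 0 ∧ 0 < x (Fin.last d)} (eN d)

/-- The last component `f_n(x) = x_n (1 + P(x) Q_g(x))² + h(x') (P(x) Q_g(x))²`. -/
noncomputable def mapLast {d m : ℕ} (g : Fin (m + 1) → MvPolynomial (Fin d) ℝ)
    (h : MvPolynomial (Fin d) ℝ) (P : MvPolynomial (Fin (d + 1)) ℝ) (x : Fin (d + 1) → ℝ) : ℝ :=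
  x (Fin.last d) * (1 + MvPolynomial.eval x P * MvPolynomial.eval x (polyQ g)) ^ 2 +
    MvPolynomial.eval (Fin.init x) h *
      (MvPolynomial.eval x P * MvPolynomial.eval x (polyQ g)) ^ 2

/-- The map `f(x', x_n) = (x', f_n(x', x_n))`. -/
noncomputable def mapF {d m : ℕ} (g : Fin (m + 1) → MvPolynomial (Fin d) ℝ)
    (h : MvPolynomial (Fin d) ℝ) (P : MvPolynomial (Fin (d + 1)) ℝ) (x : Fin (d + 1) → ℝ) :
    Fin (d + 1) → ℝ :=
  Fin.snoc (α := fun _ => ℝ) (Fin.init x) (mapLast g h P x)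

/-! ### The cleared denominators agree with the displayed formulas -/

theorem ell_cast (m : ℕ) (hm : 1 ≤ m) :
    (ell m : ℤ) = ((m : ℤ) + 1) * 2 ^ (m - 1) - (m : ℤ) ^ 2 + m := by
  obtain ⟨k, rfl⟩ : ∃ k, m = k + 1 := ⟨m - 1, by omega⟩
  have h2 : k < 2 ^ k := Nat.lt_two_pow_self
  have h3 : (k + 1) * (k + 1 - 1) ≤ (k + 1 + 1) * 2 ^ (k + 1 - 1) := by
    simp only [Nat.add_sub_cancel]
    exact Nat.mul_le_mul (by omega) h2.le
  unfold ell
  rw [Nat.cast_sub h3]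
  simp only [Nat.add_sub_cancel]
  push_cast
  ring

theorem peckerP_smul {R : Type*} [CommRing R] (m : ℕ) (c : R) (y : Fin (m + 1) → R) (t : R) :
    peckerP m (fun i => c * y i) (c * t) = c ^ 2 ^ m * peckerP m y t := by
  induction m generalizing c t with
  | zero => simp only [peckerP]; ring
  | succ m ih =>
    have h1 : auxA (fun i => c * y i) = fun k => c ^ 2 * auxA y k := by
      funext k
      simp only [auxA, ← Finset.mul_sum]
      ring
    have h2 : (c * t - ∑ i, c * y i) ^ 2 = c ^ 2 * (t - ∑ i, y i) ^ 2 := by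
      rw [← Finset.mul_sum]; ring
    simp only [peckerP]
    rw [h1, h2, ih, ← pow_mul]
    congr 2
    ring

theorem map_peckerP {R S : Type*} [CommRing R] [CommRing S] (φ : R →+* S) (m : ℕ)
    (y : Fin (m + 1) → R) (t : R) :
    φ (peckerP m y t) = peckerP m (fun i => φ (y i)) (φ t) := by
  induction m generalizing t with
  | zero => simp [peckerP]
  | succ m ih =>
    have h1 : auxA (fun i => φ (y i)) = fun k => φ (auxA y k) := by
      funext k
      simp [auxA, map_sum]
    simp only [peckerP]
    rw [h1, ih]
    simp [map_sum]

theorem modF_eq (m : ℕ) (y : Fin (m + 1) → ℝ) (hy : ∀ i, y i ≠ 0) (t : ℝ) :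
    modF m y t = (∏ j, y j) ^ 2 ^ m *
      peckerP m (Fin.snoc (α := fun _ => ℝ) (fun i : Fin m => y i.castSucc) (1 / ∏ j, y j)) t := by
  have hp : (∏ j, y j) ≠ 0 := Finset.prod_ne_zero_iff.mpr fun i _ => hy i
  rw [← peckerP_smul, modF]
  congr 1
  funext i
  refine Fin.lastCases ?_ (fun i => ?_) i
  · simp [hp]
  · simp

theorem eval_polyQ {d m : ℕ} (g : Fin (m + 1) → MvPolynomial (Fin d) ℝ) (x : Fin (d + 1) → ℝ)
    (hG : MvPolynomial.eval (Fin.init x) (g (Fin.last m)) ≠ 0) :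
    MvPolynomial.eval x (polyQ g) =
      MvPolynomial.eval (Fin.init x) (g (Fin.last m)) ^ (2 * ell (m + 1) + 2 ^ (m + 1)) *
        modQ m
          (Fin.snoc (α := fun _ => ℝ)
            (fun i : Fin m => MvPolynomial.eval (Fin.init x) (g i.castSucc)) 1)
          (x (Fin.last d) ^ 2 * constC (m + 1) /
            MvPolynomial.eval (Fin.init x) (g (Fin.last m)) ^ 2) := by
  have hC : constC (m + 1) ≠ 0 := by
    have h1 : Real.sqrt ((((m + 1 : ℕ) : ℝ) - 1) / (m + 1 : ℕ)) < 1 := by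
      rw [Real.sqrt_lt' one_pos, div_lt_iff₀ (by positivity)]
      linarith
    unfold constC
    linarith
  have hr : ∀ p : MvPolynomial (Fin d) ℝ,
      MvPolynomial.eval x (MvPolynomial.rename Fin.castSucc p) =
        MvPolynomial.eval (Fin.init x) p := by
    intro p
    rw [MvPolynomial.eval_rename]
    rfl
  have hpow : ∀ G : ℝ, G ^ (2 * ell (m + 1) + 2 ^ (m + 1)) =
      (G ^ 2) ^ ell (m + 1) * (G ^ 2) ^ 2 ^ m := by
    intro G
    rw [pow_add, pow_mul, ← pow_mul G 2 (2 ^ m), pow_succ' 2 m]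
  unfold polyQ modQ modF
  rw [map_mul, map_peckerP, hpow, mul_mul_mul_comm, ← peckerP_smul, ← mul_pow]
  congr 1
  · simp only [map_pow, map_add, MvPolynomial.eval_X, hr, Fin.snoc_last]
    congr 1
    field_simp
  · congr 1
    · funext i
      refine Fin.lastCases ?_ (fun i => ?_) i
      · simp [hr]
      · simp [hr, Fin.prod_univ_castSucc, mul_assoc]
    · simp only [map_mul, map_pow, map_prod, MvPolynomial.eval_X, MvPolynomial.eval_C, hr,
        Fin.prod_univ_castSucc, Fin.snoc_last, Fin.snoc_castSucc, mul_one]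
      field_simp

end Pecker

namespace Pecker

open Finset

/-! Put `q = P Q_g`, so that `f_n = x_n (1 + q)² + h q²`, and follow `f_n` along a vertical line.
Over a point of `A_g` there is a height where `Q_g ≤ -1`. Since `P > 1` from there upwards, `q ≤ -1`
at that height, while `q > 0` far up, so `q = -1` at some point in between. There `f_n = h`, and
`f_n → +∞` above it, so `f_n` takes every value `≥ h` on `S_g`. This is the first inclusion of (i).

For the second inclusion, `Q_g ≤ 0` at a nonnegative height forces `g_1, …, g_m > 0` and `x_n ≥
g_{m+1}`. Hence `x_n ≥ h` on `S_g`, and `2 f_n - h ≥ h (2q + 1)² ≥ 0`. Statements (ii) and (iii)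
follow from `f_n - x_n = x_n q (2 + q) + h q²` and from `Q_g > 0` off `S_g` in `x_n ≥ 0`, and far up
on each line.

These facts about `Q_g` come from Pecker's polynomial: `nonneg_of_peckerP_nonpos` (signs of the
`y_i`), `peckerP_pos_of_lt` (no zeros for small `t`), `peckerP_pos_of_two_mul_sum_le` (none for
large `t`) and `exists_peckerP_le` (depth of a negative value). The last one yields
`exists_modQ_le_neg_one`. -/

/-! ### Sign and size of Pecker's polynomials. -/

theorem auxA_castSucc {R : Type*} [CommRing R] {m : ℕ} (y : Fin (m + 3) → R) (k : Fin (m + 1)) :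
    auxA y k.castSucc = auxA (fun i : Fin (m + 2) => y i.castSucc) k := by
  unfold auxA
  rw [Fin.succ_castSucc, ← Fin.map_castSuccEmb_Iic, Finset.sum_map]
  rfl

theorem auxA_last {R : Type*} [CommRing R] {m : ℕ} (y : Fin (m + 2) → R) :
    auxA y (Fin.last m) = y (Fin.last (m + 1)) * ∑ i : Fin (m + 1), y i.castSucc := by
  unfold auxA
  rw [← Fin.map_castSuccEmb_Iic, Finset.sum_map, Fin.succ_last, ← Fin.top_eq_last m,
    Finset.Iic_top]
  rfl

/-- Each product of two distinct entries occurs exactly once among the `a_k`. -/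
theorem two_mul_sum_auxA {R : Type*} [CommRing R] {m : ℕ} (y : Fin (m + 2) → R) :
    2 * ∑ k, auxA y k = (∑ i, y i) ^ 2 - ∑ i, y i ^ 2 := by
  induction m with
  | zero =>
    rw [Fin.sum_univ_one, Fin.sum_univ_two, Fin.sum_univ_two, show (0 : Fin 1) = Fin.last 0 from rfl,
      auxA_last]
    simp
    ring
  | succ m ih =>
    rw [Fin.sum_univ_castSucc, auxA_last, Fin.sum_univ_castSucc (n := m + 2),
      Fin.sum_univ_castSucc (n := m + 2)]
    simp only [auxA_castSucc]
    rw [mul_add, ih]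
    ring

theorem auxA_nonneg {m : ℕ} {y : Fin (m + 2) → ℝ} (hy : ∀ i, 0 ≤ y i) (k : Fin (m + 1)) :
    0 ≤ auxA y k :=
  mul_nonneg (hy _) (Finset.sum_nonneg fun i _ => hy i)

/-- Nonnegativity of all `a_k` forces the entries of `y` to have a common weak sign. -/
theorem same_sign_of_auxA_nonneg {m : ℕ} (y : Fin (m + 2) → ℝ) (h : ∀ k, 0 ≤ auxA y k) :
    (∀ i, 0 ≤ y i) ∨ ∀ i, y i ≤ 0 := by
  induction m with
  | zero =>
    have h0 := h (Fin.last 0)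
    rw [auxA_last] at h0
    simp at h0
    rcases mul_nonneg_iff.1 h0 with h1 | h1
    · exact Or.inl (Fin.forall_fin_two.2 ⟨h1.2, h1.1⟩)
    · exact Or.inr (Fin.forall_fin_two.2 ⟨h1.2, h1.1⟩)
  | succ m ih =>
    have hl := h (Fin.last (m + 1))
    rw [auxA_last] at hl
    -- The last `a_k` is the last entry times the sum of the others. That sum fixes the sign of the
    -- last entry unless it is zero; terms of one sign with zero sum all vanish, and then the last
    -- entry alone decides.
    have key : (∀ i : Fin (m + 2), y i.castSucc = 0) → (∀ i, 0 ≤ y i) ∨ ∀ i, y i ≤ 0 := by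
      intro hz
      rcases le_total 0 (y (Fin.last (m + 2))) with h1 | h1
      · exact Or.inl fun i => Fin.lastCases h1 (fun j => (hz j).ge) i
      · exact Or.inr fun i => Fin.lastCases h1 (fun j => (hz j).le) i
    rcases ih (fun i => y i.castSucc) (fun k => auxA_castSucc y k ▸ h k.castSucc) with h1 | h1
    · rcases (Finset.sum_nonneg fun i _ => h1 i).eq_or_lt with h2 | h2
      · refine key fun i => ?_
        exact (Finset.sum_eq_zero_iff_of_nonneg fun i _ => h1 i).1 h2.symm i (mem_univ i)
      · exact Or.inl fun i => Fin.lastCases (nonneg_of_mul_nonneg_left hl h2) h1 i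
    · rcases (Finset.sum_nonpos fun i _ => h1 i).eq_or_lt with h2 | h2
      · refine key fun i => ?_
        exact (Finset.sum_eq_zero_iff_of_nonpos fun i _ => h1 i).1 h2 i (mem_univ i)
      · refine Or.inr fun i => Fin.lastCases ?_ h1 i
        by_contra! h3
        exact absurd hl (not_le.2 (mul_neg_of_pos_of_neg h3 h2))

/-- The condition passes to the `a_k`: `t - ∑ y ≥ ∑ y ≥ 0` gives `(t - ∑ y)² ≥ (∑ y)² ≥ 2 ∑ a_k`. -/
theorem peckerP_pos_of_two_mul_sum_le {m : ℕ} {y : Fin (m + 1) → ℝ} {t : ℝ} (hy : ∀ i, 0 ≤ y i)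
    (ht : 0 < t) (hs : 2 * ∑ i, y i ≤ t) : 0 < peckerP m y t := by
  induction m generalizing t with
  | zero =>
    have := hy 0
    simp [peckerP] at hs ⊢
    linarith
  | succ m ih =>
    have h0 : 0 ≤ ∑ i, y i := Finset.sum_nonneg fun i _ => hy i
    have h1 := two_mul_sum_auxA y
    have h2 : 0 ≤ ∑ i, y i ^ 2 := Finset.sum_nonneg fun i _ => sq_nonneg _
    have h3 : 0 < t - ∑ i, y i := by linarith
    exact ih (auxA_nonneg hy) (by positivity) (by nlinarith)

/-- By induction the `a_k` are nonnegative, so the `y_i` share a sign. If it were negative, `t - ∑ y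
≥ -∑ y > 0` would make the square at least `2 ∑ a_k`, and the polynomial positive. -/
theorem nonneg_of_peckerP_nonpos {m : ℕ} {y : Fin (m + 1) → ℝ} {t : ℝ} (ht : 0 ≤ t)
    (h : peckerP m y t ≤ 0) (i : Fin (m + 1)) : 0 ≤ y i := by
  induction m generalizing t with
  | zero =>
    rw [Fin.fin_one_eq_zero i]
    simp [peckerP] at h
    linarith
  | succ m ih =>
    have ha : ∀ k, 0 ≤ auxA y k := ih (sq_nonneg _) h
    rcases same_sign_of_auxA_nonneg y ha with h1 | h1
    · exact h1 i
    · by_contra! hi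
      have h0 : ∑ i, y i < 0 := Finset.sum_neg' (fun i _ => h1 i) ⟨i, mem_univ i, hi⟩
      have h2 : 0 ≤ ∑ i, y i ^ 2 := Finset.sum_nonneg fun i _ => sq_nonneg _
      refine absurd h (not_le.2 (peckerP_pos_of_two_mul_sum_le (m := m) ha ?_ ?_))
      · have : 0 < t - ∑ i, y i := by linarith
        positivity
      · rw [two_mul_sum_auxA]
        nlinarith

/-- Cauchy–Schwarz on `m + 1` entries gives `2 ∑ a_k ≤ (m / (m + 1)) (∑ y)²`; the constant `C_{m+1}`
comes from this ratio. -/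
theorem peckerP_pos_of_lt_sq {m : ℕ} (hm : 1 ≤ m) {y : Fin (m + 1) → ℝ} {t : ℝ}
    (hy : ∀ i, 0 ≤ y i) (ht : (m : ℝ) / (m + 1) * (∑ i, y i) ^ 2 < (t - ∑ i, y i) ^ 2) :
    0 < peckerP m y t := by
  obtain ⟨m, rfl⟩ : ∃ k, m = k + 1 := ⟨m - 1, by omega⟩
  refine peckerP_pos_of_two_mul_sum_le (m := m) (auxA_nonneg hy) (lt_of_le_of_lt (by positivity) ht)
    (le_trans ?_ ht.le)
  rw [two_mul_sum_auxA]
  have h := sq_sum_le_card_mul_sum_sq (s := univ) (f := y)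
  simp only [card_univ, Fintype.card_fin] at h
  push_cast at h ⊢
  rw [div_mul_eq_mul_div, le_div_iff₀ (by positivity)]
  nlinarith

theorem constC_pos (m : ℕ) : 0 < constC (m + 1) := by
  have h1 : Real.sqrt ((((m + 1 : ℕ) : ℝ) - 1) / (m + 1 : ℕ)) < 1 := by
    rw [Real.sqrt_lt' one_pos, div_lt_iff₀ (by positivity)]
    linarith
  unfold constC
  linarith

theorem constC_le_one (m : ℕ) : constC m ≤ 1 := by
  unfold constC
  linarith [Real.sqrt_nonneg (((m : ℝ) - 1) / m)]

theorem peckerP_pos_of_lt {m : ℕ} (hm : 1 ≤ m) {y : Fin (m + 1) → ℝ} {t : ℝ}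
    (hy : ∀ i, 0 ≤ y i) (ht : t < constC (m + 1) * ∑ i, y i) : 0 < peckerP m y t := by
  refine peckerP_pos_of_lt_sq hm hy ?_
  have h0 : 0 ≤ ∑ i, y i := Finset.sum_nonneg fun i _ => hy i
  unfold constC at ht
  push_cast at ht
  rw [add_sub_cancel_right] at ht
  have h1 : (0 : ℝ) ≤ m / (m + 1) := by positivity
  rw [← Real.sq_sqrt h1, ← mul_pow, ← neg_sq (t - _)]
  refine pow_lt_pow_left₀ (by linarith) (by positivity) two_ne_zero

/-- A quantitative estimate of how negative `P_{m+1}(y, ·)` becomes to the right of `∑ y_i`. -/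
theorem exists_peckerP_le {m : ℕ} (hm : 1 ≤ m) {y : Fin (m + 1) → ℝ} {δ : ℝ} (hδ : 0 < δ)
    (hy : ∀ i, δ ≤ y i) :
    ∃ t, ∑ i, y i ≤ t ∧ peckerP m y t ≤ -((∏ i, y i) * δ ^ (2 ^ m - (m + 1))) := by
  induction m, hm using Nat.le_induction generalizing δ with
  | base =>
    refine ⟨∑ i, y i, le_rfl, ?_⟩
    have := auxA_last y
    simp [peckerP, Fin.prod_univ_two] at this ⊢
    rw [this]
    linarith
  | succ m hm ih =>
    have hpos : ∀ i, 0 < y i := fun i => hδ.trans_le (hy i)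
    have hs : ∀ k : Fin (m + 1), δ ≤ ∑ i ∈ Finset.Iic k.castSucc, y i := fun k =>
      (hy k.castSucc).trans
        (Finset.single_le_sum (fun i _ => (hpos i).le) (Finset.mem_Iic.2 le_rfl))
    have ha : ∀ k, δ ^ 2 ≤ auxA y k := fun k => by
      rw [sq]
      exact mul_le_mul (hy _) (hs k) hδ.le (hpos _).le
    obtain ⟨t, ht, hPt⟩ := ih (y := auxA y) (pow_pos hδ 2) ha
    have ht0 : 0 ≤ t :=
      (Finset.sum_nonneg fun k _ => (pow_pos hδ 2).le.trans (ha k)).trans ht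
    -- This choice turns the inner argument `(t - ∑ y)²` into the point found for the `a_k`.
    refine ⟨∑ i, y i + √t, by linarith [Real.sqrt_nonneg t], ?_⟩
    rw [peckerP, add_sub_cancel_left, Real.sq_sqrt ht0]
    refine hPt.trans (neg_le_neg ?_)
    -- The factors `y_{k+1}` of the `a_k`, with the first partial sum `y_1`, rebuild `∏ y`; the
    -- other `m` partial sums are at least `δ`.
    have hprod : (∏ i, y i) * δ ^ m ≤ ∏ k, auxA y k := by
      unfold auxA
      rw [Finset.prod_mul_distrib, Fin.prod_univ_succ, mul_comm (y 0), mul_assoc]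
      refine mul_le_mul_of_nonneg_left ?_ (Finset.prod_nonneg fun i _ => (hpos _).le)
      rw [Fin.prod_univ_succ]
      have h0 : ∑ i ∈ Finset.Iic (Fin.castSucc (0 : Fin (m + 1))), y i = y 0 := by
        rw [Fin.castSucc_zero, ← bot_eq_zero, Finset.Iic_bot, Finset.sum_singleton]
      rw [h0]
      refine mul_le_mul_of_nonneg_left ?_ (hpos 0).le
      calc δ ^ m = ∏ _k : Fin m, δ := by simp
        _ ≤ _ := Finset.prod_le_prod (fun _ _ => hδ.le) fun k _ => hs k.succ
    have hexp : 2 ^ (m + 1) - (m + 1 + 1) = m + 2 * (2 ^ m - (m + 1)) := by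
      have : m < 2 ^ m := Nat.lt_two_pow_self
      rw [pow_succ]
      omega
    rw [hexp, pow_add, pow_mul, ← mul_assoc]
    exact mul_le_mul_of_nonneg_right hprod (by positivity)

/-! ### The polynomial `F_{m+1}(y_1, …, y_m, 1, t)` -/

/-- The point `(y_1, …, y_m, 1 / (y_1 ⋯ y_m))`. -/
noncomputable def snocInvProd {m : ℕ} (y : Fin m → ℝ) : Fin (m + 1) → ℝ :=
  Fin.snoc (α := fun _ => ℝ) y (∏ i, y i)⁻¹

theorem prod_snocInvProd {m : ℕ} {y : Fin m → ℝ} (hy : ∀ i, y i ≠ 0) :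
    ∏ i, snocInvProd y i = 1 := by
  rw [Fin.prod_univ_castSucc]
  simp [snocInvProd, mul_inv_cancel₀ (Finset.prod_ne_zero_iff.2 fun i _ => hy i)]

theorem snocInvProd_pos {m : ℕ} {y : Fin m → ℝ} (hy : ∀ i, 0 < y i) (i : Fin (m + 1)) :
    0 < snocInvProd y i := by
  refine Fin.lastCases ?_ (fun j => ?_) i
  · simpa [snocInvProd] using Finset.prod_pos fun i _ => hy i
  · simpa [snocInvProd] using hy j

theorem one_le_sum_of_prod_eq_one {n : ℕ} {y : Fin (n + 1) → ℝ} (hy : ∀ i, 0 < y i)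
    (h : ∏ i, y i = 1) : 1 ≤ ∑ i, y i := by
  have h1 : ∏ i, y i ≤ ∏ _i : Fin (n + 1), ∑ j, y j :=
    Finset.prod_le_prod (fun i _ => (hy i).le) fun i hi =>
      Finset.single_le_sum (fun j _ => (hy j).le) hi
  rw [h, Finset.prod_const, card_univ, Fintype.card_fin] at h1
  by_contra! h2
  exact absurd h1 (not_le.2
    (pow_lt_one₀ (Finset.sum_nonneg fun i _ => (hy i).le) h2 (Nat.succ_ne_zero n)))

/-- The other `n` entries are each at most the sum, and their product is `1 / y_i`. -/
theorem inv_sum_pow_le_of_prod_eq_one {n : ℕ} {y : Fin (n + 1) → ℝ} (hy : ∀ i, 0 < y i)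
    (h : ∏ i, y i = 1) (i : Fin (n + 1)) : ((∑ j, y j) ^ n)⁻¹ ≤ y i := by
  have hS := one_le_sum_of_prod_eq_one hy h
  rw [inv_le_iff_one_le_mul₀ (by positivity)]
  calc (1 : ℝ) = y i * ∏ j : Fin n, y (i.succAbove j) := by
        rw [← h, Fin.prod_univ_succAbove _ i]
    _ ≤ y i * ∏ _j : Fin n, ∑ j, y j := by
        refine mul_le_mul_of_nonneg_left ?_ (hy i).le
        exact Finset.prod_le_prod (fun j _ => (hy _).le) fun j _ =>
          Finset.single_le_sum (fun j _ => (hy j).le) (mem_univ _)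
    _ = y i * (∑ j, y j) ^ n := by simp

theorem modF_snoc_one {m : ℕ} {y : Fin m → ℝ} (hy : ∀ i, y i ≠ 0) (t : ℝ) :
    modF m (Fin.snoc (α := fun _ => ℝ) y 1) t =
      (∏ i, y i) ^ 2 ^ m * peckerP m (snocInvProd y) t := by
  rw [modF_eq]
  · simp [Fin.prod_univ_castSucc, snocInvProd]
  · exact fun i => Fin.lastCases (by simp) (fun j => by simpa using hy j) i

theorem pos_of_modF_nonpos {m : ℕ} (hm : 1 ≤ m) {y : Fin m → ℝ} {t : ℝ} (ht : 0 ≤ t)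
    (h : modF m (Fin.snoc (α := fun _ => ℝ) y 1) t ≤ 0) (i : Fin m) : 0 < y i := by
  by_cases hy : ∀ i, y i ≠ 0
  · rw [modF_snoc_one hy] at h
    -- Since `m ≥ 1`, the exponent `2 ^ m` is even and the sign of the product is irrelevant.
    have h0 : 0 < (∏ i, y i) ^ 2 ^ m :=
      (even_two.pow_of_ne_zero (by omega)).pow_pos (Finset.prod_ne_zero_iff.2 fun i _ => hy i)
    have h1 := nonneg_of_peckerP_nonpos ht (nonpos_of_mul_nonpos_right h h0) i.castSucc
    simp only [snocInvProd, Fin.snoc_castSucc] at h1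
    exact h1.lt_of_ne (hy i).symm
  -- If some `y_i` vanishes, the value collapses to that of Pecker's polynomial at `(0, …, 0, 1)`
  -- and `t = 0`, which is positive because `0 < C_{m+1}`.
  · refine absurd h (not_le.2 ?_)
    have hp : ∏ j, (Fin.snoc (α := fun _ => ℝ) y 1 : Fin (m + 1) → ℝ) j = 0 := by
      push Not at hy
      obtain ⟨j, hj⟩ := hy
      exact Finset.prod_eq_zero (mem_univ j.castSucc) (by simpa using hj)
    unfold modF
    rw [hp]
    refine peckerP_pos_of_lt hm (fun j => Fin.lastCases (by simp) (fun k => by simp) j) ?_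
    simpa [Fin.sum_univ_castSucc] using constC_pos m

theorem constC_le_of_modF_nonpos {m : ℕ} (hm : 1 ≤ m) {y : Fin m → ℝ} {t : ℝ}
    (hy : ∀ i, 0 < y i) (h : modF m (Fin.snoc (α := fun _ => ℝ) y 1) t ≤ 0) :
    constC (m + 1) ≤ t := by
  by_contra! ht
  have h0 : 0 < ∏ i, y i := Finset.prod_pos fun i _ => hy i
  rw [modF_snoc_one fun i => (hy i).ne'] at h
  refine absurd (nonpos_of_mul_nonpos_right h (pow_pos h0 _)) (not_le.2 ?_)
  refine peckerP_pos_of_lt hm (fun i => (snocInvProd_pos hy i).le) (ht.trans_le ?_)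
  exact le_mul_of_one_le_right (constC_pos m).le (one_le_sum_of_prod_eq_one (snocInvProd_pos hy)
    (prod_snocInvProd fun i => (hy i).ne'))

theorem exists_forall_modF_pos {m : ℕ} (hm : 1 ≤ m) (y : Fin m → ℝ) :
    ∃ T, ∀ t, T ≤ t → 0 < modF m (Fin.snoc (α := fun _ => ℝ) y 1) t := by
  by_cases hy : ∀ i, 0 < y i
  · refine ⟨max 1 (2 * ∑ i, snocInvProd y i), fun t ht => ?_⟩
    rw [modF_snoc_one fun i => (hy i).ne']
    have h0 : 0 < ∏ i, y i := Finset.prod_pos fun i _ => hy i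
    refine mul_pos (pow_pos h0 _) (peckerP_pos_of_two_mul_sum_le
      (fun i => (snocInvProd_pos hy i).le) ?_ ((le_max_right _ _).trans ht))
    exact one_pos.trans_le ((le_max_left _ _).trans ht)
  · refine ⟨0, fun t ht => ?_⟩
    by_contra! h
    exact hy (pos_of_modF_nonpos hm ht h)

/-- Over the points with positive coordinates, the modified Pecker polynomial takes values
below `-1`; this is what the exponent `ℓ(m+1)` is for. -/
theorem exists_modQ_le_neg_one {m : ℕ} (hm : 1 ≤ m) {y : Fin m → ℝ} (hy : ∀ i, 0 < y i) :
    ∃ t, 0 < t ∧ modQ m (Fin.snoc (α := fun _ => ℝ) y 1) t ≤ -1 := by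
  have hz := snocInvProd_pos hy
  have hz1 := prod_snocInvProd fun i => (hy i).ne'
  have hS := one_le_sum_of_prod_eq_one hz hz1
  have hδ := inv_sum_pow_le_of_prod_eq_one hz hz1
  have hlast : (∏ i, y i)⁻¹ ≤ ∑ i, snocInvProd y i := by
    have := Finset.single_le_sum (fun i _ => (hz i).le) (mem_univ (Fin.last m))
    simpa [snocInvProd] using this
  set S := ∑ i, snocInvProd y i with hSdef
  have hS0 : 0 < S := by linarith
  have hπ : 0 < ∏ i, y i := Finset.prod_pos fun i _ => hy i
  obtain ⟨t, ht, hP⟩ := exists_peckerP_le hm (inv_pos.2 (pow_pos hS0 m)) hδ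
  rw [hz1, one_mul] at hP
  have ht0 : 0 < t := hS0.trans_le ht
  refine ⟨t, ht0, ?_⟩
  have hSt : S ≤ t / constC (m + 1) + 1 := by
    have : t ≤ t / constC (m + 1) := by
      rw [le_div_iff₀ (constC_pos m)]
      exact mul_le_of_le_one_right ht0.le (constC_le_one _)
    linarith
  -- The three summands of the exponent: two absorb `(∏ y)^{2^m} ≥ S^{-2^m}` and the loss `S^{-m}`
  -- per factor in `exists_peckerP_le`; the spare `S^{2^m}` is at least `1`.
  have hell : ell (m + 1) = 2 ^ m + (m * (2 ^ m - (m + 1)) + 2 ^ m) := by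
    have h1 : m < 2 ^ m := Nat.lt_two_pow_self
    obtain ⟨r, hr⟩ := Nat.exists_eq_add_of_le (Nat.succ_le_of_lt h1)
    unfold ell
    simp only [Nat.add_sub_cancel]
    rw [hr, Nat.succ_eq_add_one, Nat.add_sub_cancel_left]
    refine Nat.sub_eq_of_eq_add ?_
    ring
  have h1 : S⁻¹ ≤ ∏ i, y i := inv_le_of_inv_le₀ hπ hlast
  have h2 : 1 ≤ S ^ ell (m + 1) * (S⁻¹ ^ 2 ^ m * (S ^ m)⁻¹ ^ (2 ^ m - (m + 1))) := by
    rw [hell, pow_add, pow_add, pow_mul, inv_pow, inv_pow]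
    have h3 : S ^ 2 ^ m ≠ 0 := by positivity
    have h4 : (S ^ m) ^ (2 ^ m - (m + 1)) ≠ 0 := by positivity
    calc (1 : ℝ) ≤ S ^ 2 ^ m := one_le_pow₀ hS
      _ = _ := by field_simp
  unfold modQ
  rw [Fin.snoc_last, modF_snoc_one fun i => (hy i).ne']
  have h5 : S ^ ell (m + 1) * S⁻¹ ^ 2 ^ m ≤
      (t / constC (m + 1) + 1) ^ ell (m + 1) * (∏ i, y i) ^ 2 ^ m := by
    have : 0 < S⁻¹ := inv_pos.2 hS0
    have : 0 ≤ t / constC (m + 1) + 1 := hS0.le.trans hSt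
    gcongr
  have h6 : 0 ≤ (S ^ m)⁻¹ ^ (2 ^ m - (m + 1)) := by positivity
  rw [← mul_assoc]
  have h7 := mul_le_mul_of_nonneg_left hP (a :=
    (t / constC (m + 1) + 1) ^ ell (m + 1) * (∏ i, y i) ^ 2 ^ m) (le_trans (by positivity) h5)
  have h8 := mul_le_mul_of_nonneg_right h5 h6
  rw [← mul_assoc] at h2
  linarith

/-! ### The polynomial `Q_g` on vertical lines -/

section Fibers

variable {d m : ℕ} {g : Fin (m + 1) → MvPolynomial (Fin d) ℝ}

/-- The values at `x'` of the first `m` members of a tuple of polynomials. -/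
noncomputable def evalInit (g : Fin (m + 1) → MvPolynomial (Fin d) ℝ) (x' : Fin d → ℝ) :
    Fin m → ℝ :=
  fun i => MvPolynomial.eval x' (g i.castSucc)

theorem mem_setA_iff {x : Fin (d + 1) → ℝ} :
    x ∈ setA g ↔ (∀ i, 0 < evalInit g (Fin.init x) i) ∧ x (Fin.last d) = 0 := Iff.rfl

theorem snoc_zero_mem_setA {x' : Fin d → ℝ} (h : ∀ i, 0 < evalInit g x' i) :
    (Fin.snoc (α := fun _ => ℝ) x' 0 : Fin (d + 1) → ℝ) ∈ setA g := by
  rw [mem_setA_iff]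
  simpa using h

theorem snoc_add_smul_eN (x' : Fin d → ℝ) (s c : ℝ) :
    (Fin.snoc (α := fun _ => ℝ) x' s : Fin (d + 1) → ℝ) + c • eN d =
      (Fin.snoc (α := fun _ => ℝ) x' (s + c) : Fin (d + 1) → ℝ) := by
  funext i
  refine Fin.lastCases ?_ (fun j => ?_) i
  · simp [eN]
  · simp [eN]

theorem add_smul_eN (x : Fin (d + 1) → ℝ) (c : ℝ) :
    x + c • eN d = Fin.snoc (α := fun _ => ℝ) (Fin.init x) (x (Fin.last d) + c) := by
  rw [← snoc_add_smul_eN]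
  congr 1
  exact (Fin.snoc_init_self x).symm

theorem mem_cyl_setA_iff {x : Fin (d + 1) → ℝ} :
    x ∈ cyl (setA g) (eN d) ↔ ∀ i, 0 < evalInit g (Fin.init x) i := by
  constructor
  · rintro ⟨x, hx, c, rfl⟩
    rw [add_smul_eN, Fin.init_snoc]
    exact hx.1
  · intro h
    refine ⟨_, snoc_zero_mem_setA h, x (Fin.last d), ?_⟩
    rw [snoc_add_smul_eN, zero_add]
    exact (Fin.snoc_init_self x).symm

theorem mem_posCyl_setA_iff {x : Fin (d + 1) → ℝ} :
    x ∈ posCyl (setA g) (eN d) ↔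
      (∀ i, 0 < evalInit g (Fin.init x) i) ∧ 0 ≤ x (Fin.last d) := by
  constructor
  · rintro ⟨x, hx, c, hc, rfl⟩
    rw [add_smul_eN, Fin.init_snoc, Fin.snoc_last, hx.2, zero_add]
    exact ⟨hx.1, hc⟩
  · rintro ⟨h, h0⟩
    refine ⟨_, snoc_zero_mem_setA h, x (Fin.last d), h0, ?_⟩
    rw [snoc_add_smul_eN, zero_add]
    exact (Fin.snoc_init_self x).symm

theorem mem_setS_iff {x : Fin (d + 1) → ℝ} :
    x ∈ setS g ↔ ∃ s, 0 < s ∧ s ≤ x (Fin.last d) ∧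
      MvPolynomial.eval (Fin.snoc (α := fun _ => ℝ) (Fin.init x) s : Fin (d + 1) → ℝ)
        (polyQ g) ≤ 0 := by
  constructor
  · rintro ⟨x, ⟨hQ, hx⟩, c, hc, rfl⟩
    rw [add_smul_eN, Fin.init_snoc, Fin.snoc_last]
    refine ⟨x (Fin.last d), hx, by linarith, ?_⟩
    rwa [Fin.snoc_init_self]
  · rintro ⟨s, hs, hsx, hQ⟩
    refine ⟨_, ⟨hQ, by simpa using hs⟩, x (Fin.last d) - s, by linarith, ?_⟩
    rw [snoc_add_smul_eN, add_sub_cancel]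
    exact (Fin.snoc_init_self x).symm

theorem eval_snoc_polyQ (hg : IsAdmissible g) (x' : Fin d → ℝ) (s : ℝ) :
    MvPolynomial.eval (Fin.snoc (α := fun _ => ℝ) x' s : Fin (d + 1) → ℝ) (polyQ g) =
      MvPolynomial.eval x' (g (Fin.last m)) ^ (2 * ell (m + 1) + 2 ^ (m + 1)) *
        modQ m (Fin.snoc (α := fun _ => ℝ) (evalInit g x') 1)
          (s ^ 2 * constC (m + 1) / MvPolynomial.eval x' (g (Fin.last m)) ^ 2) := by
  have hG := hg.2 x'
  rw [eval_polyQ g _ (by rw [Fin.init_snoc]; linarith), Fin.init_snoc, Fin.snoc_last]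
  rfl

theorem modQ_pos_iff {y : Fin m → ℝ} {t : ℝ} (ht : 0 ≤ t) :
    0 < modQ m (Fin.snoc (α := fun _ => ℝ) y 1) t ↔
      0 < modF m (Fin.snoc (α := fun _ => ℝ) y 1) t := by
  unfold modQ
  rw [Fin.snoc_last, mul_pos_iff_of_pos_left]
  have := div_nonneg ht (constC_pos m).le
  positivity

theorem eval_snoc_polyQ_pos_iff (hg : IsAdmissible g) (x' : Fin d → ℝ) (s : ℝ) :
    0 < MvPolynomial.eval (Fin.snoc (α := fun _ => ℝ) x' s : Fin (d + 1) → ℝ) (polyQ g) ↔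
      0 < modF m (Fin.snoc (α := fun _ => ℝ) (evalInit g x') 1)
          (s ^ 2 * constC (m + 1) / MvPolynomial.eval x' (g (Fin.last m)) ^ 2) := by
  have hG : 0 < MvPolynomial.eval x' (g (Fin.last m)) := one_pos.trans (hg.2 x')
  have := constC_pos m
  rw [eval_snoc_polyQ hg, mul_pos_iff_of_pos_left (by positivity), modQ_pos_iff (by positivity)]

theorem pos_of_eval_polyQ_nonpos (hg : IsAdmissible g) {x' : Fin d → ℝ} {s : ℝ}
    (h : MvPolynomial.eval (Fin.snoc (α := fun _ => ℝ) x' s : Fin (d + 1) → ℝ) (polyQ g) ≤ 0)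
    (i : Fin m) : 0 < evalInit g x' i := by
  rw [← not_lt, eval_snoc_polyQ_pos_iff hg, not_lt] at h
  have := constC_pos m
  exact pos_of_modF_nonpos hg.1 (by positivity) h i

/-- The factor `C_{m+1} / g_{m+1}²` in the substitution turns the threshold `t ≥ C_{m+1}` into `s ≥
g_{m+1}`. -/
theorem le_of_eval_polyQ_nonpos (hg : IsAdmissible g) {x' : Fin d → ℝ} {s : ℝ} (hs : 0 ≤ s)
    (h : MvPolynomial.eval (Fin.snoc (α := fun _ => ℝ) x' s : Fin (d + 1) → ℝ) (polyQ g) ≤ 0) :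
    MvPolynomial.eval x' (g (Fin.last m)) ≤ s := by
  have hpos := pos_of_eval_polyQ_nonpos hg h
  rw [← not_lt, eval_snoc_polyQ_pos_iff hg, not_lt] at h
  have hG : 0 < MvPolynomial.eval x' (g (Fin.last m)) := one_pos.trans (hg.2 x')
  have h1 := constC_le_of_modF_nonpos hg.1 hpos h
  rw [le_div_iff₀ (by positivity), mul_comm] at h1
  exact le_of_sq_le_sq (le_of_mul_le_mul_right h1 (constC_pos m)) hs

theorem eval_polyQ_pos_of_last_eq_zero (hg : IsAdmissible g) (x' : Fin d → ℝ) :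
    0 < MvPolynomial.eval (Fin.snoc (α := fun _ => ℝ) x' 0 : Fin (d + 1) → ℝ) (polyQ g) := by
  by_contra! h
  exact absurd (one_pos.trans (hg.2 x')) (not_lt.2 (le_of_eval_polyQ_nonpos hg le_rfl h))

theorem eventually_eval_polyQ_pos (hg : IsAdmissible g) (x' : Fin d → ℝ) :
    ∀ᶠ s : ℝ in Filter.atTop,
      0 < MvPolynomial.eval (Fin.snoc (α := fun _ => ℝ) x' s : Fin (d + 1) → ℝ) (polyQ g) := by
  simp only [eval_snoc_polyQ_pos_iff hg]
  obtain ⟨T, hT⟩ := exists_forall_modF_pos hg.1 (evalInit g x')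
  have hG : 0 < MvPolynomial.eval x' (g (Fin.last m)) := one_pos.trans (hg.2 x')
  have h : Filter.Tendsto (fun s : ℝ =>
      s ^ 2 * constC (m + 1) / MvPolynomial.eval x' (g (Fin.last m)) ^ 2)
      Filter.atTop Filter.atTop :=
    ((Filter.tendsto_pow_atTop two_ne_zero).atTop_mul_const (constC_pos m)).atTop_div_const
      (by positivity)
  exact (h.eventually_ge_atTop T).mono fun s hs => hT _ hs

theorem exists_eval_polyQ_le_neg_one (hg : IsAdmissible g) {x' : Fin d → ℝ}
    (h : ∀ i, 0 < evalInit g x' i) :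
    ∃ s : ℝ, 0 < s ∧
      MvPolynomial.eval (Fin.snoc (α := fun _ => ℝ) x' s : Fin (d + 1) → ℝ) (polyQ g) ≤ -1 := by
  obtain ⟨t, ht, hQ⟩ := exists_modQ_le_neg_one hg.1 h
  have hG := hg.2 x'
  set G := MvPolynomial.eval x' (g (Fin.last m)) with hGdef
  have hG0 : 0 < G := by linarith
  have hC := constC_pos m
  -- This height solves `C_{m+1} s² / G² = t`; the prefactor is a power of `G > 1`, so it preserves
  -- the bound `-1`.
  refine ⟨√(t * G ^ 2 / constC (m + 1)), by positivity, ?_⟩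
  rw [eval_snoc_polyQ hg, Real.sq_sqrt (by positivity), ← hGdef,
    show t * G ^ 2 / constC (m + 1) * constC (m + 1) / G ^ 2 = t by field_simp]
  have h1 : 1 ≤ G ^ (2 * ell (m + 1) + 2 ^ (m + 1)) := one_le_pow₀ hG.le
  nlinarith

/-! ### The map `f` -/

variable {h : MvPolynomial (Fin d) ℝ} {P : MvPolynomial (Fin (d + 1)) ℝ}

theorem mapF_last (x : Fin (d + 1) → ℝ) : mapF g h P x (Fin.last d) = mapLast g h P x := by
  simp [mapF]

theorem le_mapLast {x : Fin (d + 1) → ℝ} (hx : 0 ≤ x (Fin.last d))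
    (hPQ : 0 ≤ MvPolynomial.eval x P * MvPolynomial.eval x (polyQ g))
    (hh : 0 ≤ MvPolynomial.eval (Fin.init x) h) : x (Fin.last d) ≤ mapLast g h P x := by
  unfold mapLast
  generalize MvPolynomial.eval x P * MvPolynomial.eval x (polyQ g) = q at hPQ ⊢
  have h1 : 0 ≤ MvPolynomial.eval (Fin.init x) h * q ^ 2 := by positivity
  have h2 : 0 ≤ x (Fin.last d) * (q * (2 + q)) := by positivity
  nlinarith

theorem continuous_eval_snoc (p : MvPolynomial (Fin (d + 1)) ℝ) (x' : Fin d → ℝ) :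
    Continuous fun s : ℝ =>
      MvPolynomial.eval (Fin.snoc (α := fun _ => ℝ) x' s : Fin (d + 1) → ℝ) p := by
  refine (MvPolynomial.continuous_eval p).comp ?_
  refine continuous_pi fun i => Fin.lastCases ?_ (fun j => ?_) i
  · simpa using continuous_id'
  · simpa using continuous_const

theorem continuous_mapLast_snoc (x' : Fin d → ℝ) :
    Continuous fun s : ℝ =>
      mapLast g h P (Fin.snoc (α := fun _ => ℝ) x' s : Fin (d + 1) → ℝ) := by
  have h1 := continuous_eval_snoc P x'
  have h2 := continuous_eval_snoc (polyQ g) x'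
  simp only [mapLast, Fin.init_snoc, Fin.snoc_last]
  fun_prop

theorem tendsto_mapLast_snoc (hg : IsAdmissible g) {x' : Fin d → ℝ}
    (hh : 0 ≤ MvPolynomial.eval x' h)
    (hP : ∀ᶠ s : ℝ in Filter.atTop,
      0 ≤ MvPolynomial.eval (Fin.snoc (α := fun _ => ℝ) x' s : Fin (d + 1) → ℝ) P) :
    Filter.Tendsto (fun s : ℝ =>
      mapLast g h P (Fin.snoc (α := fun _ => ℝ) x' s : Fin (d + 1) → ℝ))
      Filter.atTop Filter.atTop := by
  refine Filter.tendsto_atTop_mono' _ ?_ Filter.tendsto_id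
  filter_upwards [hP, eventually_eval_polyQ_pos hg x', Filter.eventually_ge_atTop 0]
    with s hPs hQs hs
  have := le_mapLast (g := g) (h := h) (P := P)
    (x := (Fin.snoc (α := fun _ => ℝ) x' s : Fin (d + 1) → ℝ))
    (by simpa using hs) (mul_nonneg hPs hQs.le) (by simpa using hh)
  simpa using this

theorem pos_of_mem_setS (hg : IsAdmissible g) {x : Fin (d + 1) → ℝ} (hx : x ∈ setS g) (i : Fin m) :
    0 < evalInit g (Fin.init x) i := by
  obtain ⟨s, -, -, hQ⟩ := mem_setS_iff.1 hx
  exact pos_of_eval_polyQ_nonpos hg hQ i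

theorem le_last_of_mem_setS (hg : IsAdmissible g) {x : Fin (d + 1) → ℝ} (hx : x ∈ setS g) :
    MvPolynomial.eval (Fin.init x) (g (Fin.last m)) ≤ x (Fin.last d) := by
  obtain ⟨s, hs, hsx, hQ⟩ := mem_setS_iff.1 hx
  exact (le_of_eval_polyQ_nonpos hg hs.le hQ).trans hsx

theorem le_two_mul_mapLast {x : Fin (d + 1) → ℝ} (h0 : 0 ≤ MvPolynomial.eval (Fin.init x) h)
    (hx : MvPolynomial.eval (Fin.init x) h ≤ x (Fin.last d)) :
    MvPolynomial.eval (Fin.init x) h ≤ 2 * mapLast g h P x := by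
  unfold mapLast
  generalize MvPolynomial.eval x P * MvPolynomial.eval x (polyQ g) = q
  have h1 := mul_le_mul_of_nonneg_right hx (sq_nonneg (1 + q))
  -- The factor 2 in the bound comes from `2 (1 + q)² + 2 q² - 1 = (2q + 1)²`.
  have h2 := mul_nonneg h0 (sq_nonneg (2 * q + 1))
  nlinarith

theorem subset_image_mapF (hg : IsAdmissible g)
    (h_nonneg : ∀ x ∈ setA g, 0 ≤ MvPolynomial.eval (Fin.init x) h)
    (hP : ∀ x ∈ setS g, 1 < MvPolynomial.eval x P) :
    cyl (setA g) (eN d) ∩ {x | MvPolynomial.eval (Fin.init x) h ≤ x (Fin.last d)} ⊆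
      mapF g h P '' setS g := by
  rintro z ⟨hzA, hz⟩
  rw [mem_cyl_setA_iff] at hzA
  set x' := Fin.init z with hx'
  have hh : 0 ≤ MvPolynomial.eval x' h := by
    simpa using h_nonneg _ (snoc_zero_mem_setA hzA)
  obtain ⟨s₀, hs₀, hQ₀⟩ := exists_eval_polyQ_le_neg_one hg hzA
  have hmem : ∀ s, s₀ ≤ s → (Fin.snoc (α := fun _ => ℝ) x' s : Fin (d + 1) → ℝ) ∈ setS g := by
    intro s hs
    rw [mem_setS_iff, Fin.init_snoc, Fin.snoc_last]
    exact ⟨s₀, hs₀, hs, hQ₀.trans (by norm_num)⟩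
  have hP' : ∀ s, s₀ ≤ s →
      1 < MvPolynomial.eval (Fin.snoc (α := fun _ => ℝ) x' s : Fin (d + 1) → ℝ) P :=
    fun s hs => hP _ (hmem s hs)
  obtain ⟨s₁, hs₁, hq₁⟩ : ∃ s₁, s₀ ≤ s₁ ∧
      MvPolynomial.eval (Fin.snoc (α := fun _ => ℝ) x' s₁ : Fin (d + 1) → ℝ) P *
        MvPolynomial.eval (Fin.snoc (α := fun _ => ℝ) x' s₁ : Fin (d + 1) → ℝ) (polyQ g) = -1 := by
    obtain ⟨b, hQb, hb⟩ :=
      ((eventually_eval_polyQ_pos hg x').and (Filter.eventually_ge_atTop s₀)).exists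
    have hc := (continuous_eval_snoc P x').mul (continuous_eval_snoc (polyQ g) x')
    have h_a : MvPolynomial.eval (Fin.snoc (α := fun _ => ℝ) x' s₀ : Fin (d + 1) → ℝ) P *
        MvPolynomial.eval (Fin.snoc (α := fun _ => ℝ) x' s₀ : Fin (d + 1) → ℝ) (polyQ g) ≤ -1 := by
      nlinarith [hP' s₀ le_rfl]
    have h_b := mul_pos (one_pos.trans (hP' b hb)) hQb
    obtain ⟨s, hs, hqs⟩ := intermediate_value_Icc hb hc.continuousOn
      ⟨h_a, neg_one_lt_zero.le.trans h_b.le⟩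
    exact ⟨s, hs.1, hqs⟩
  have hf₁ : mapLast g h P (Fin.snoc (α := fun _ => ℝ) x' s₁ : Fin (d + 1) → ℝ) =
      MvPolynomial.eval x' h := by
    simp [mapLast, hq₁]
  have hP_ev : ∀ᶠ s : ℝ in Filter.atTop,
      0 ≤ MvPolynomial.eval (Fin.snoc (α := fun _ => ℝ) x' s : Fin (d + 1) → ℝ) P :=
    (Filter.eventually_ge_atTop s₀).mono fun s hs => (one_pos.trans (hP' s hs)).le
  obtain ⟨b, hfb, hb⟩ := (((tendsto_mapLast_snoc hg hh hP_ev).eventually_ge_atTop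
    (z (Fin.last d))).and (Filter.eventually_ge_atTop s₁)).exists
  obtain ⟨s, hs, hfs⟩ := intermediate_value_Icc hb
    (continuous_mapLast_snoc (g := g) (h := h) (P := P) x').continuousOn
    (show z (Fin.last d) ∈ Set.Icc _ _ from ⟨hf₁.trans_le hz, hfb⟩)
  refine ⟨_, hmem s (hs₁.trans hs.1), ?_⟩
  unfold mapF
  rw [Fin.init_snoc]
  simp only at hfs
  rw [hfs, hx']
  exact Fin.snoc_init_self z

theorem image_mapF_subset (hg : IsAdmissible g)
    (h_nonneg : ∀ x ∈ setA g, 0 ≤ MvPolynomial.eval (Fin.init x) h)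
    (hgh : ∀ x ∈ setA g,
      MvPolynomial.eval (Fin.init x) h < MvPolynomial.eval (Fin.init x) (g (Fin.last m))) :
    mapF g h P '' setS g ⊆
      cyl (setA g) (eN d) ∩ {x | MvPolynomial.eval (Fin.init x) h ≤ 2 * x (Fin.last d)} := by
  rintro _ ⟨x, hx, rfl⟩
  have hpos := pos_of_mem_setS hg hx
  have hA := snoc_zero_mem_setA hpos
  have h0 := h_nonneg _ hA
  have h1 := hgh _ hA
  rw [Fin.init_snoc] at h0 h1
  have hinit : Fin.init (mapF g h P x) = Fin.init x := Fin.init_snoc _ _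
  refine ⟨mem_cyl_setA_iff.2 (hinit.symm ▸ hpos), ?_⟩
  rw [Set.mem_ofPred_eq, hinit, mapF_last]
  exact le_two_mul_mapLast h0 (h1.le.trans (le_last_of_mem_setS hg hx))

/-- For `x_n > 0` this is the definition of `S_g` with `λ = 0`; the plane `x_n = 0`, excluded there,
needs the bound `x_n ≥ g_{m+1} > 0`. -/
theorem eval_polyQ_pos_of_notMem_setS (hg : IsAdmissible g) {x : Fin (d + 1) → ℝ}
    (hx : 0 ≤ x (Fin.last d)) (hxS : x ∉ setS g) : 0 < MvPolynomial.eval x (polyQ g) := by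
  rw [← Fin.snoc_init_self (α := fun _ => ℝ) x]
  rcases hx.eq_or_lt with h0 | h0
  · rw [← h0]
    exact eval_polyQ_pos_of_last_eq_zero hg _
  · by_contra! hQ
    exact hxS (mem_setS_iff.2 ⟨_, h0, le_rfl, hQ⟩)

end Fibers

end Pecker

/-! ### The theorem, assembled from the statements on vertical lines. -/

theorem theorem3p5 {d m : ℕ} (g : Fin (m + 1) → MvPolynomial (Fin d) ℝ)
    (hg : Pecker.IsAdmissible g)
    (h : MvPolynomial (Fin d) ℝ) (P : MvPolynomial (Fin (d + 1)) ℝ)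
    (h_nonneg : ∀ x ∈ Pecker.setA g, 0 ≤ MvPolynomial.eval (Fin.init x) h)
    (hP : ∀ x ∈ Pecker.setS g, 1 < MvPolynomial.eval x P)
    (hgh : ∀ x ∈ Pecker.setA g,
      MvPolynomial.eval (Fin.init x) h < MvPolynomial.eval (Fin.init x) (g (Fin.last m))) :
    -- (i)
    (Pecker.cyl (Pecker.setA g) (Pecker.eN d) ∩
          {x | MvPolynomial.eval (Fin.init x) h ≤ x (Fin.last d)} ⊆
        Pecker.mapF g h P '' Pecker.setS g ∧
      Pecker.mapF g h P '' Pecker.setS g ⊆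
        Pecker.cyl (Pecker.setA g) (Pecker.eN d) ∩
          {x | MvPolynomial.eval (Fin.init x) h ≤ 2 * x (Fin.last d)} ∧
      (h = 0 →
        Pecker.mapF g h P '' Pecker.setS g = Pecker.posCyl (Pecker.setA g) (Pecker.eN d))) ∧
    -- (ii)
    ((∀ x : Fin (d + 1) → ℝ, 0 ≤ x (Fin.last d) →
        0 ≤ MvPolynomial.eval x P * MvPolynomial.eval x (Pecker.polyQ g) →
        0 ≤ MvPolynomial.eval (Fin.init x) h →
        x (Fin.last d) ≤ Pecker.mapF g h P x (Fin.last d)) ∧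
      (∀ x ∈ Pecker.posCyl (Pecker.setA g) (Pecker.eN d) \ Pecker.setS g,
        0 ≤ MvPolynomial.eval x P →
        0 ≤ x (Fin.last d) ∧
        0 ≤ MvPolynomial.eval x P * MvPolynomial.eval x (Pecker.polyQ g) ∧
        0 ≤ MvPolynomial.eval (Fin.init x) h ∧
        x (Fin.last d) ≤ Pecker.mapF g h P x (Fin.last d))) ∧
    -- (iii)
    (∀ x' : Fin d → ℝ, 0 ≤ MvPolynomial.eval x' h →
      (∀ᶠ s : ℝ in Filter.atTop,
        0 ≤ MvPolynomial.eval (Fin.snoc (α := fun _ => ℝ) x' s : Fin (d + 1) → ℝ) P) →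
      Filter.Tendsto
        (fun s : ℝ =>
          Pecker.mapF g h P (Fin.snoc (α := fun _ => ℝ) x' s : Fin (d + 1) → ℝ) (Fin.last d))
        Filter.atTop Filter.atTop) := by
  have h_sub := Pecker.subset_image_mapF hg h_nonneg hP
  have h_sup := Pecker.image_mapF_subset (P := P) hg h_nonneg hgh
  refine ⟨⟨h_sub, h_sup, ?_⟩, ⟨?_, ?_⟩, ?_⟩
  · rintro rfl
    refine Set.Subset.antisymm (fun z hz => ?_) (fun z hz => h_sub ?_)
    · obtain ⟨hzA, hz0⟩ := h_sup hz
      rw [Set.mem_ofPred_eq, map_zero] at hz0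
      exact Pecker.mem_posCyl_setA_iff.2 ⟨Pecker.mem_cyl_setA_iff.1 hzA, by linarith⟩
    · obtain ⟨hzA, hz0⟩ := Pecker.mem_posCyl_setA_iff.1 hz
      exact ⟨Pecker.mem_cyl_setA_iff.2 hzA, by rwa [Set.mem_ofPred_eq, map_zero]⟩
  · intro x hx hPQ hh
    rw [Pecker.mapF_last]
    exact Pecker.le_mapLast hx hPQ hh
  · rintro x ⟨hxA, hxS⟩ hPx
    obtain ⟨hpos, hx⟩ := Pecker.mem_posCyl_setA_iff.1 hxA
    have hPQ := mul_nonneg hPx (Pecker.eval_polyQ_pos_of_notMem_setS hg hx hxS).le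
    have hh := h_nonneg _ (Pecker.snoc_zero_mem_setA hpos)
    rw [Fin.init_snoc] at hh
    rw [Pecker.mapF_last]
    exact ⟨hx, hPQ, hh, Pecker.le_mapLast hx hPQ hh⟩
  · intro x' hh hPx
    simp only [Pecker.mapF_last]
    exact Pecker.tendsto_mapLast_snoc hg hh hPx
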